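/- Conventions. A Radon space is a topological space homeomorphic to a universally measurable subspace of a compact metric space; $\mathscr E^u$ denotes the universally measurable sets of $E$. A right process on a Radon space $E$ is a system $X=(\Omega,\mathscr G,(\mathscr G_t)_{t\ge 0},(X_t)_{t\ge 0},(\theta_t)_{t\ge 0},(P^x)_{x\in E})$ such that: each $P^x$ is a probability measure on $(\Omega,\mathscr G)$ and $x\mapsto P^x(H)$ is $\mathscr E^u$-measurable for $H\in\mathscr G$; $(\mathscr G_t)$ is a right continuous filtration, and $\mathscr G$, $(\mathscr G_t)$ are augmented with respect to the laws $P^\mu=\int\mu(dx)\,P^x$, $\mu$ a probability measure on $E$; $X_t$ is $\mathscr G_t/\mathscr E^u$-measurable, $t\mapsto X_t(\omega)$ is right continuous, $P^x(X_0=x)=1$, and $X_s\circ\theta_t=X_{s+t}$; the Markov property $E^\mu[f(X_{t+s})\mid\mathscr G_t]=T_sf(X_t)$ holds for every $\mu$ and every nonnegative $\mathscr E^u$-measurable $f$, where $T_sf(x)=E^x[f(X_s)]$; and for every $\alpha>0$, every $\alpha$-excessive function $f$ of $(T_t)$ and every $\mu$, the map $t\mapsto f(X_t)$ is $P^\mu$-a.s.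 right continuous. A set $A\in\mathscr E^u$ is absorbing for $X$ if $P^x(X_t\in A\text{ for all }t\ge 0)=1$ for all $x\in A$. A cemetery point is a point $\Delta$ for which $\{\Delta\}$ is absorbing. Theorem. Let $\widetilde E=E_\Delta\uplus F$ be the topological (disjoint) union of two Radon spaces $E_\Delta$ and $F$, with a point $\Delta\in E_\Delta$. Let $X$ be a right process on $\widetilde E$ with cemetery point $\Delta$, and let $F$ be absorbing for $X$. Let $\psi\colon\widetilde E\to E_\Delta$ be the identity on $E_\Delta$ and $\psi(x)=\Delta$ for $x\in F$. Then $\psi(X)$ is a right process on $E_\Delta$ with cemetery point $\Delta$. Here $\psi(X)$ is the process with paths $t\mapsto\psi(X_t)$ on the sample space of $X$, with the same shifts, with the measures $P^x$, $x\in E_\Delta$, and with the augmentation of $\mathscr G$, $(\mathscr G_t)$ (and the corresponding extension of $P^x$) with respect to the laws $P^\mu$, $\mu$ a probability measure on $E_\Delta$. Moreover, for every $x\in\widetilde E$, the law of $(\psi(X_t))_{t\ge 0}$ under $P^x$ is that of the process $\psi(X)$ started in $\psi(x)$: $P^x(H)=P^{\psi(x)}(H)$ for all $H\in\sigma(\psi(X_t):t\ge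 0)$, where $E_\Delta$ carries its universally measurable $\sigma$-algebra. -/

import Mathlib

open MeasureTheory ProbabilityTheory Filter Topology Set
open scoped NNReal ENNReal

universe u v w

namespace RightProc

/-! ### Universally measurable sets, completions, Radon spaces -/

/-- The σ-algebra `𝓔ᵘ` of universally measurable subsets of a topological space `E`: the sets which
are measurable for the completion of every probability measure on the Borel σ-algebra of `E`. -/
@[reducible] def univMeas (E : Type u) [TopologicalSpace E] : MeasurableSpace E where
  MeasurableSet' A := ∀ μ : Measure[borel E] E, IsProbabilityMeasure μ →
    @NullMeasurableSet E (borel E) A μ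
  measurableSet_empty := fun μ _ => @nullMeasurableSet_empty E (borel E) μ
  measurableSet_compl := fun _ hA μ hμ => (hA μ hμ).compl
  measurableSet_iUnion := fun _ hA μ hμ => NullMeasurableSet.iUnion fun n => hA n μ hμ

/-- A Radon space: a topological space which is homeomorphic to a universally measurable subspace
of a compact metrizable space. -/
def IsRadonSpace (E : Type u) [TopologicalSpace E] : Prop :=
  ∃ (K : Type u) (_ : TopologicalSpace K) (_ : CompactSpace K) (_ : TopologicalSpace.MetrizableSpace K)
    (e : E → K), IsEmbedding e ∧ MeasurableSet[univMeas K] (range e)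

/-- The extension of a measure `μ` to a σ-algebra `m'` that consists of `μ`-completion measurable
sets (the restriction to `m'` of the completion of `μ`). -/
noncomputable def extendMeasure {Ω : Type v} (m' : MeasurableSpace Ω)
    {m : MeasurableSpace Ω} (μ : Measure[m] Ω) (h : ∀ A, MeasurableSet[m'] A → NullMeasurableSet A μ) :
    Measure[m'] Ω :=
  @Measure.trim Ω m' (inferInstanceAs (MeasurableSpace (NullMeasurableSpace Ω μ))) μ.completion h

theorem extendMeasure_apply {Ω : Type v} (m' : MeasurableSpace Ω)
    {m : MeasurableSpace Ω} (μ : Measure[m] Ω) (h : ∀ A, MeasurableSet[m'] A → NullMeasurableSet A μ)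
    {A : Set Ω} (hA : MeasurableSet[m'] A) : extendMeasure m' μ h A = μ A :=
  @trim_measurableSet_eq Ω m' (inferInstanceAs (MeasurableSpace (NullMeasurableSpace Ω μ)))
    μ.completion A h hA

theorem borel_le_univMeas (E : Type u) [TopologicalSpace E] : borel E ≤ univMeas E :=
  fun _ hA _ _ => hA.nullMeasurableSet

theorem measurable_univMeas_of_continuous {E : Type u} {E' : Type v} [TopologicalSpace E]
    [TopologicalSpace E'] {f : E → E'} (hf : Continuous f) :
    @Measurable E E' (univMeas E) (univMeas E') f := by
  intro A hA μ hμ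
  let _ : MeasurableSpace E := borel E
  let _ : MeasurableSpace E' := borel E'
  have hm : Measurable f := hf.borel_measurable
  exact (hA _ (Measure.isProbabilityMeasure_map hm.aemeasurable)).preimage
    ⟨hm, Measure.AbsolutelyContinuous.rfl⟩

/-- Passing to universally measurable sets a second time gives nothing new. -/
theorem measurableSet_univMeas_of_forall {E : Type u} [TopologicalSpace E] {A : Set E}
    (hA : ∀ μ : Measure[univMeas E] E, IsProbabilityMeasure μ →
      @NullMeasurableSet E (univMeas E) A μ) : MeasurableSet[univMeas E] A := by
  intro μ hμ
  let ν : Measure[univMeas E] E := extendMeasure (univMeas E) μ fun B hB => hB μ hμ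
  have happ : ∀ B, MeasurableSet[univMeas E] B → ν B = μ B := fun B hB =>
    extendMeasure_apply _ μ _ hB
  have hν : IsProbabilityMeasure ν := ⟨by rw [happ _ MeasurableSet.univ]; exact hμ.measure_univ⟩
  obtain ⟨B, hB, hAB⟩ := hA ν hν
  have hBμ : @NullMeasurableSet E (borel E) B μ := hB μ hμ
  refine hBμ.congr ?_
  have h0 : ∀ C, ν C = 0 → μ C = 0 := by
    intro C hC
    obtain ⟨D, hCD, hD, hD0⟩ := @exists_measurable_superset_of_null E (univMeas E) ν C hC
    exact measure_mono_null hCD (by rw [← happ D hD]; exact hD0)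
  have h1 : ν {x | ¬ (A x = B x)} = 0 := hAB
  exact (show B =ᵐ[μ] A from EventuallyEq.symm (h0 _ h1))

/-! ### Markovian systems -/

/-- The data `(Ω, 𝓖, (𝓖ₜ), (Xₜ), (θₜ), (Pˣ))` of a process in `E`: a filtered measurable space,
`E`-valued random variables `Xₜ`, shift maps `θₜ`, and measures `Pˣ` on `(Ω, 𝓖)` that depend
on `x ∈ E` in a universally measurable way. -/
structure MarkovSystem (E : Type u) [TopologicalSpace E] where
  Ω : Type v
  𝓖 : MeasurableSpace Ω
  filt : Filtration ℝ≥0 𝓖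
  X : ℝ≥0 → Ω → E
  θ : ℝ≥0 → Ω → Ω
  P : Kernel[univMeas E, 𝓖] E Ω

namespace MarkovSystem

attribute [instance] MarkovSystem.𝓖

section

variable {E : Type u} [TopologicalSpace E] (S : MarkovSystem.{u, v} E)

/-- The measure `P^μ = ∫ μ(dx) Pˣ` for an initial law `μ`. -/
noncomputable def law (μ : Measure[univMeas E] E) : Measure[S.𝓖] S.Ω :=
  @Measure.bind E S.Ω (univMeas E) S.𝓖 μ S.P

/-- The transition operators `Pₜ f (x) = Eˣ f(Xₜ)`. -/
noncomputable def semigroup (t : ℝ≥0) (f : E → ℝ≥0∞) (x : E) : ℝ≥0∞ :=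
  @lintegral S.Ω S.𝓖 (S.P x) fun ω => f (S.X t ω)

/-- `α`-excessive functions: nonnegative universally measurable `f` with `e^{-αt} Pₜ f ≤ f` for all
`t`, and `e^{-αt} Pₜ f → f` pointwise as `t ↓ 0`. -/
structure IsExcessive (α : ℝ≥0) (f : E → ℝ≥0∞) : Prop where
  measurable : Measurable[univMeas E] f
  le : ∀ (t : ℝ≥0) (x : E), ENNReal.ofReal (Real.exp (-((α : ℝ) * (t : ℝ)))) * S.semigroup t f x ≤ f x
  tendsto : ∀ x, Tendsto (fun t : ℝ≥0 => ENNReal.ofReal (Real.exp (-((α : ℝ) * (t : ℝ)))) * S.semigroup t f x)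
    (𝓝[>] 0) (𝓝 (f x))

/-- `S` is a right process on the Radon space `E`: a normal, right continuous Markov process with
shifts over a right continuous, augmented filtration, such that `t ↦ f(Xₜ)` is almost surely right
continuous for all `α`-excessive functions `f`, `α > 0`. -/
structure IsRightProc : Prop where
  radon : IsRadonSpace E
  isProbabilityMeasure : ∀ x, IsProbabilityMeasure (S.P x)
  adapted : ∀ t, @Measurable S.Ω E (S.filt t) (univMeas E) (S.X t)
  normal : ∀ x, ∀ᵐ ω ∂(S.P x), S.X 0 ω = x
  rightContinuous : ∀ ω t, ContinuousWithinAt (fun s => S.X s ω) (Ici t) t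
  shift : ∀ s t ω, S.X s (S.θ t ω) = S.X (s + t) ω
  /-- The simple Markov property `E^μ[f(X_{t+s}) | 𝓖ₜ] = P_s f (Xₜ)`, for every initial law. -/
  markov : ∀ μ : Measure[univMeas E] E, IsProbabilityMeasure μ → ∀ (s t : ℝ≥0) (f : E → ℝ≥0∞),
    Measurable[univMeas E] f → ∀ H : Set S.Ω, MeasurableSet[S.filt t] H →
      ∫⁻ ω in H, f (S.X (t + s) ω) ∂(S.law μ) = ∫⁻ ω in H, S.semigroup s f (S.X t ω) ∂(S.law μ)
  excessive_rightContinuous : ∀ α : ℝ≥0, 0 < α → ∀ f : E → ℝ≥0∞, S.IsExcessive α f →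
    ∀ μ : Measure[univMeas E] E, IsProbabilityMeasure μ →
      ∀ᵐ ω ∂(S.law μ), ∀ t, ContinuousWithinAt (fun s => f (S.X s ω)) (Ici t) t
  filt_rightContinuous : ∀ t (A : Set S.Ω), (∀ s, t < s → MeasurableSet[S.filt s] A) →
    MeasurableSet[S.filt t] A
  /-- `𝓖` is the intersection of its completions with respect to the laws `P^μ`. -/
  augmented : ∀ A : Set S.Ω, (∀ μ : Measure[univMeas E] E, IsProbabilityMeasure μ →
    NullMeasurableSet A (S.law μ)) → MeasurableSet[S.𝓖] A
  /-- `𝓖ₜ` is the intersection over `μ` of the σ-algebras generated by `𝓖ₜ` and the `P^μ`-null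
  sets. -/
  filt_augmented : ∀ t (A : Set S.Ω), (∀ μ : Measure[univMeas E] E, IsProbabilityMeasure μ →
    ∃ B, MeasurableSet[S.filt t] B ∧ A =ᵐ[S.law μ] B) → MeasurableSet[S.filt t] A

/-- A universally measurable set `A` is absorbing for the process if, started in `A`, the process
almost surely stays in `A` for all times. -/
def IsAbsorbing (A : Set E) : Prop :=
  MeasurableSet[univMeas E] A ∧ ∀ x ∈ A, ∀ᵐ ω ∂(S.P x), ∀ t, S.X t ω ∈ A

/-! ### Augmentation -/

/-- The intersection of the completions of `𝓖` with respect to all laws `P^μ`. -/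
@[reducible] def augSigma : MeasurableSpace S.Ω where
  MeasurableSet' A := ∀ μ : Measure[univMeas E] E, IsProbabilityMeasure μ →
    NullMeasurableSet A (S.law μ)
  measurableSet_empty := fun _ _ => nullMeasurableSet_empty
  measurableSet_compl := fun _ hA μ hμ => (hA μ hμ).compl
  measurableSet_iUnion := fun _ hA μ hμ => NullMeasurableSet.iUnion fun n => hA n μ hμ

/-- The intersection over all `μ` of the σ-algebras generated by `𝓖ₜ` and the `P^μ`-null sets. -/
def augFilt : @Filtration S.Ω ℝ≥0 _ S.augSigma where
  seq t :=
    { MeasurableSet' := fun A => ∀ μ : Measure[univMeas E] E, IsProbabilityMeasure μ →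
        ∃ B, MeasurableSet[S.filt t] B ∧ A =ᵐ[S.law μ] B
      measurableSet_empty := fun _ _ => ⟨∅, @MeasurableSet.empty _ (S.filt t), EventuallyEq.rfl⟩
      measurableSet_compl := fun A hA μ hμ => by
        obtain ⟨B, hB, hAB⟩ := hA μ hμ
        exact ⟨Bᶜ, hB.compl, hAB.compl⟩
      measurableSet_iUnion := fun A hA μ hμ => by
        choose B hB hAB using fun n => hA n μ hμ
        exact ⟨⋃ n, B n, MeasurableSet.iUnion hB, Filter.EventuallyEq.countable_iUnion hAB⟩ }
  mono' := fun s t hst A hA μ hμ => by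
    obtain ⟨B, hB, hAB⟩ := hA μ hμ
    exact ⟨B, S.filt.mono hst B hB, hAB⟩
  le' := fun t A hA μ hμ => by
    obtain ⟨B, hB, hAB⟩ := hA μ hμ
    exact ⟨B, S.filt.le t B hB, hAB⟩

theorem law_dirac (x : E) : S.law (@Measure.dirac E (univMeas E) x) = S.P x :=
  @Measure.dirac_bind E S.Ω (univMeas E) S.𝓖 S.P S.P.measurable x

theorem nullMeasurableSet_of_augSigma {A : Set S.Ω} (hA : MeasurableSet[S.augSigma] A) (x : E) :
    NullMeasurableSet A (S.P x) := by
  rw [← S.law_dirac x]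
  exact hA _ (@Measure.dirac.isProbabilityMeasure E (univMeas E) x)

theorem measurable_P_of_augSigma {A : Set S.Ω} (hA : MeasurableSet[S.augSigma] A) :
    Measurable[univMeas E] fun x => S.P x A := by
  intro T hT
  refine measurableSet_univMeas_of_forall fun μ hμ => ?_
  obtain ⟨B, hB, hAB⟩ := hA μ hμ
  have hae : ∀ᵐ x ∂μ, ∀ᵐ ω ∂(S.P x), A ω = B ω :=
    @Measure.ae_ae_of_ae_bind E S.Ω (univMeas E) S.𝓖 μ S.P _
      (@Measurable.aemeasurable E _ (univMeas E) _ _ μ S.P.measurable) hAB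
  have hm : Measurable[univMeas E] fun x => S.P x B :=
    @Kernel.measurable_coe E S.Ω (univMeas E) S.𝓖 S.P B hB
  refine NullMeasurableSet.congr (s := (fun x => S.P x B) ⁻¹' T)
    (@MeasurableSet.nullMeasurableSet E (univMeas E) μ _ (hm hT)) ?_
  filter_upwards [hae] with x hx
  have : S.P x A = S.P x B := measure_congr hx
  exact propext (by change S.P x B ∈ T ↔ S.P x A ∈ T; rw [this])

/-- The same process with `𝓖` and `(𝓖ₜ)` replaced by their augmentations, and with every `Pˣ`
extended to the augmented σ-algebra. -/
noncomputable def augment : MarkovSystem.{u, v} E where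
  Ω := S.Ω
  𝓖 := S.augSigma
  filt := S.augFilt
  X := S.X
  θ := S.θ
  P := @Kernel.mk E S.Ω (univMeas E) S.augSigma
    (fun x => extendMeasure S.augSigma (S.P x) fun _ hA => S.nullMeasurableSet_of_augSigma hA x)
    (@Measure.measurable_of_measurable_coe S.Ω E S.augSigma (univMeas E) _ fun A hA => by
      simp only [extendMeasure_apply _ _ _ hA]
      exact S.measurable_P_of_augSigma hA)

end

/-! ### Killing on an absorbing set -/

/-- The map `ψ` on the topological union of `EΔ` and `F` which is the identity on `EΔ` and sends all
of `F` to the cemetery `Δ`. -/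
def killMap {EΔ : Type u} (F : Type w) (Δ : EΔ) : EΔ ⊕ F → EΔ :=
  Sum.elim id fun _ => Δ

/-- The process `ψ(X)` on `EΔ`: it has the paths `t ↦ ψ(Xₜ)` on the same sample space, the law of `X`
started in `x` as its law for the starting point `x ∈ EΔ`, and the augmentation of the given
filtration with respect to these laws. -/
noncomputable def kill {EΔ : Type u} {F : Type w} [TopologicalSpace EΔ] [TopologicalSpace F]
    (S : MarkovSystem.{max u w, v} (EΔ ⊕ F)) (Δ : EΔ) : MarkovSystem.{u, v} EΔ :=
  MarkovSystem.augment
    { Ω := S.Ω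
      𝓖 := S.𝓖
      filt := S.filt
      X := fun t ω => killMap F Δ (S.X t ω)
      θ := S.θ
      P := @Kernel.comap (EΔ ⊕ F) S.Ω (univMeas _) S.𝓖 EΔ (univMeas EΔ) S.P Sum.inl
        (measurable_univMeas_of_continuous continuous_inl) }

end MarkovSystem

end RightProc

/-! The map `ψ = killMap F Δ` intertwines the semigroups `T` of `X` and `Q` of `ψ(X)`: `(Q_t f) ∘ ψ
= T_t (f ∘ ψ)` (`killRaw_semigroup`). On `EΔ` this is the definition of `Q`; on `F` both sides equal
`f Δ`, because `F` and `{Δ}` are absorbing and `ψ(X)` therefore almost surely rests in `Δ`. Hence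
the Markov property of `X`, applied to `f ∘ ψ`, is that of `ψ(X)`. If `f` is `α`-excessive for `Q`,
then `f ∘ ψ` is so for `T`, and `f(ψ(X_t))` inherits right continuity. The paths are right
continuous since `ψ` is continuous. Equality of the laws is again the resting argument. It remains
to pass to the augmentation (`isRightProc_augment`), which changes neither null sets nor the
transition operators on universally measurable functions, and preserves right continuity of the
filtration. -/

namespace RightProc

attribute [local instance] univMeas
-- The sum σ-algebra would compete with the universally measurable one on `EΔ ⊕ F`.
attribute [-instance] Sum.instMeasurableSpace

/-! ### Null sets and integrals for extended measures -/

section extend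

variable {Ω : Type v} {m' m : MeasurableSpace Ω} {μ : Measure[m] Ω}
  {h : ∀ A, MeasurableSet[m'] A → NullMeasurableSet A μ}

/-- A null set has a measurable null hull, in `m'` or in `m`, and on such hulls the two measures
agree. -/
theorem extendMeasure_eq_zero_iff (hm : m ≤ m') (A : Set Ω) :
    extendMeasure m' μ h A = 0 ↔ μ A = 0 := by
  constructor
  · intro hA
    obtain ⟨D, hAD, hD, hD0⟩ := @exists_measurable_superset_of_null Ω m' _ A hA
    exact measure_mono_null hAD (by rw [← extendMeasure_apply m' μ h hD]; exact hD0)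
  · intro hA
    obtain ⟨D, hAD, hD, hD0⟩ := @exists_measurable_superset_of_null Ω m _ A hA
    exact measure_mono_null hAD (by rw [extendMeasure_apply m' μ h (hm D hD)]; exact hD0)

theorem ae_extendMeasure (hm : m ≤ m') :
    ae (extendMeasure m' μ h) = ae μ := by
  ext s
  exact extendMeasure_eq_zero_iff hm sᶜ

theorem trim_extendMeasure (hm : m ≤ m') : (extendMeasure m' μ h).trim hm = μ := by
  refine Measure.ext fun s hs => ?_
  rw [trim_measurableSet_eq hm hs, extendMeasure_apply m' μ h (hm s hs)]

theorem lintegral_extendMeasure (hm : m ≤ m') {f : Ω → ℝ≥0∞} (hf : Measurable[m] f) :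
    ∫⁻ ω, f ω ∂(extendMeasure m' μ h) = ∫⁻ ω, f ω ∂μ := by
  rw [← lintegral_trim hm hf, trim_extendMeasure hm]

theorem setLIntegral_extendMeasure (hm : m ≤ m') {f : Ω → ℝ≥0∞} (hf : Measurable[m] f)
    {s : Set Ω} (hs : MeasurableSet[m] s) :
    ∫⁻ ω in s, f ω ∂(extendMeasure m' μ h) = ∫⁻ ω in s, f ω ∂μ := by
  rw [← @lintegral_indicator _ m' _ _ (hm s hs), ← lintegral_indicator hs,
    lintegral_extendMeasure hm (hf.indicator hs)]

theorem nullMeasurableSet_of_extendMeasure (hm : m ≤ m') {A : Set Ω}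
    (hA : @NullMeasurableSet Ω m' A (extendMeasure m' μ h)) : NullMeasurableSet A μ := by
  obtain ⟨B, hB, hAB⟩ := hA
  have hAB' : A =ᵐ[μ] B := by
    rw [← ae_extendMeasure (h := h) hm]; exact hAB
  exact (h B hB).congr hAB'.symm

end extend

namespace MarkovSystem

/-! ### Augmentation of a system -/

section augment

variable {E : Type u} [TopologicalSpace E] (S : MarkovSystem.{u, v} E)

theorem le_augSigma : S.𝓖 ≤ S.augSigma := fun _ hA _ _ => hA.nullMeasurableSet

theorem filt_le_augFilt (t : ℝ≥0) : S.filt t ≤ S.augFilt t :=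
  fun A hA _ _ => ⟨A, hA, EventuallyEq.rfl⟩

theorem law_apply (μ : Measure E) {A : Set S.Ω} (hA : MeasurableSet[S.𝓖] A) :
    S.law μ A = ∫⁻ x, S.P x A ∂μ :=
  Measure.bind_apply hA S.P.measurable.aemeasurable

theorem augment_P_apply (x : E) {A : Set S.Ω} (hA : MeasurableSet[S.augSigma] A) :
    S.augment.P x A = S.P x A :=
  extendMeasure_apply S.augSigma (S.P x)
    (fun _ hB => S.nullMeasurableSet_of_augSigma hB x) hA

/-- A set `A` of the augmentation differs from some `B` in `𝓖` by a `P^μ`-null set, which is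
`Pˣ`-null for `μ`-almost every `x`; so integrating `Pˣ(A)` or `Pˣ(B)` over `μ` is the same. -/
theorem augment_law (μ : Measure E) (hμ : IsProbabilityMeasure μ) :
    S.augment.law μ = extendMeasure S.augSigma (S.law μ) fun _ hA => hA μ hμ := by
  refine @Measure.ext _ S.augSigma _ _ fun A hA => ?_
  rw [extendMeasure_apply _ _ _ hA]
  obtain ⟨B, hB, hAB⟩ := hA μ hμ
  have hae : ∀ᵐ x ∂μ, ∀ᵐ ω ∂(S.P x), A ω = B ω :=
    Measure.ae_ae_of_ae_bind S.P.measurable.aemeasurable hAB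
  calc S.augment.law μ A = ∫⁻ x, S.P x A ∂μ :=
        (S.augment.law_apply μ hA).trans (lintegral_congr fun x => S.augment_P_apply x hA)
    _ = ∫⁻ x, S.P x B ∂μ := by
        refine lintegral_congr_ae ?_
        filter_upwards [hae] with x hx using measure_congr hx
    _ = S.law μ A := by rw [measure_congr hAB, S.law_apply μ hB]

theorem ae_augment_P {x : E} {p : S.Ω → Prop} :
    (∀ᵐ ω ∂(S.augment.P x), p ω) ↔ ∀ᵐ ω ∂(S.P x), p ω :=
  extendMeasure_eq_zero_iff (h := fun _ hA => S.nullMeasurableSet_of_augSigma hA x)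
    S.le_augSigma {ω | ¬ p ω}

theorem ae_augment_law {μ : Measure E} (hμ : IsProbabilityMeasure μ) {p : S.Ω → Prop} :
    (∀ᵐ ω ∂(S.augment.law μ), p ω) ↔ ∀ᵐ ω ∂(S.law μ), p ω := by
  rw [S.augment_law μ hμ]
  exact extendMeasure_eq_zero_iff S.le_augSigma {ω | ¬ p ω}

theorem augment_semigroup {t : ℝ≥0} (hX : Measurable (S.X t)) {f : E → ℝ≥0∞} (hf : Measurable f) :
    S.augment.semigroup t f = S.semigroup t f :=
  funext fun x => lintegral_extendMeasure
    (h := fun _ hA => S.nullMeasurableSet_of_augSigma hA x) S.le_augSigma (hf.comp hX)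

theorem measurable_semigroup {t : ℝ≥0} (hX : Measurable (S.X t)) {f : E → ℝ≥0∞}
    (hf : Measurable f) : Measurable (S.semigroup t f) :=
  (hf.comp hX).lintegral_kernel

/-- The augmentation of a right continuous filtration is right continuous. -/
theorem augFilt_rightContinuous
    (hS : ∀ t (A : Set S.Ω), (∀ s, t < s → MeasurableSet[S.filt s] A) → MeasurableSet[S.filt t] A)
    (t : ℝ≥0) (A : Set S.Ω) (hA : ∀ s, t < s → MeasurableSet[S.augFilt s] A) :
    MeasurableSet[S.augFilt t] A := by
  intro μ hμ
  obtain ⟨u, hu_anti, htu, hu⟩ := exists_seq_strictAnti_tendsto t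
  choose B hB hAB using fun n => hA (u n) (htu n) μ hμ
  -- The witness is `limsup B n`: it does not depend on finitely many terms, so it lies in `𝓖ₛ` for
  -- every `s > t`, and it equals `A` wherever all `B n` agree with `A`.
  refine ⟨⋂ N, ⋃ n, B (N + n), hS t _ fun s hs => ?_, ?_⟩
  · obtain ⟨K, hK⟩ := (hu.eventually (gt_mem_nhds hs)).exists
    have hanti : Antitone fun N => ⋃ n, B (N + n) := fun N M hNM =>
      iUnion_subset fun n => subset_iUnion_of_subset (M - N + n) (by
        rw [show N + (M - N + n) = M + n by omega])
    have heq : ⋂ N, ⋃ n, B (N + n) = ⋂ N, ⋃ n, B (K + N + n) :=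
      Subset.antisymm (subset_iInter fun N => iInter_subset _ (K + N))
        (subset_iInter fun N => iInter_subset_of_subset N (hanti (by omega)))
    rw [heq]
    refine MeasurableSet.iInter fun N => MeasurableSet.iUnion fun n => ?_
    exact S.filt.mono ((hu_anti.antitone (by omega : K ≤ K + N + n)).trans hK.le) _ (hB _)
  · have hall : ∀ᵐ ω ∂(S.law μ), ∀ n, A ω = B n ω := ae_all_iff.2 hAB
    filter_upwards [hall] with ω hω
    have hω' : ∀ n, ω ∈ B n ↔ ω ∈ A := fun n => Iff.of_eq (hω n).symm
    refine propext ?_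
    change ω ∈ A ↔ ω ∈ ⋂ N, ⋃ n, B (N + n)
    simp [hω']

/-- A system that satisfies the axioms of a right process, except that its σ-algebras may not be
augmented, becomes a right process by augmentation. -/
theorem isRightProc_augment (radon : IsRadonSpace E)
    (isProbabilityMeasure : ∀ x, IsProbabilityMeasure (S.P x))
    (adapted : ∀ t, Measurable[S.filt t] (S.X t))
    (normal : ∀ x, ∀ᵐ ω ∂(S.P x), S.X 0 ω = x)
    (rightContinuous : ∀ ω t, ContinuousWithinAt (fun s => S.X s ω) (Ici t) t)
    (shift : ∀ s t ω, S.X s (S.θ t ω) = S.X (s + t) ω)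
    (markov : ∀ μ : Measure E, IsProbabilityMeasure μ → ∀ (s t : ℝ≥0) (f : E → ℝ≥0∞),
      Measurable f → ∀ H : Set S.Ω, MeasurableSet[S.filt t] H →
        ∫⁻ ω in H, f (S.X (t + s) ω) ∂(S.law μ) = ∫⁻ ω in H, S.semigroup s f (S.X t ω) ∂(S.law μ))
    (excessive_rightContinuous : ∀ α : ℝ≥0, 0 < α → ∀ f : E → ℝ≥0∞, S.IsExcessive α f →
      ∀ μ : Measure E, IsProbabilityMeasure μ →
        ∀ᵐ ω ∂(S.law μ), ∀ t, ContinuousWithinAt (fun s => f (S.X s ω)) (Ici t) t)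
    (filt_rightContinuous : ∀ t (A : Set S.Ω), (∀ s, t < s → MeasurableSet[S.filt s] A) →
      MeasurableSet[S.filt t] A) :
    S.augment.IsRightProc := by
  have hX : ∀ t, Measurable (S.X t) := fun t => (adapted t).mono (S.filt.le t) le_rfl
  refine
    { radon := radon
      isProbabilityMeasure := fun x => ⟨?_⟩
      adapted := fun t => (adapted t).mono (S.filt_le_augFilt t) le_rfl
      normal := fun x => ?_
      rightContinuous := rightContinuous
      shift := shift
      markov := fun μ hμ s t f hf H hH => ?_
      excessive_rightContinuous := fun α hα f hf μ hμ => ?_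
      filt_rightContinuous := S.augFilt_rightContinuous filt_rightContinuous
      augmented := fun A hA μ hμ => ?_
      filt_augmented := fun t A hA μ hμ => ?_ }
  · exact (S.augment_P_apply x (@MeasurableSet.univ _ S.augSigma)).trans (isProbabilityMeasure x).measure_univ
  · exact S.ae_augment_P.2 (normal x)
  -- Replacing `H` by an almost surely equal `B` in the original `𝓖ₜ` reduces the claim to the given
  -- Markov property.
  · obtain ⟨B, hB, hHB⟩ := hH μ hμ
    have hHB' : H =ᵐ[S.augment.law μ] B := (S.ae_augment_law hμ).2 hHB
    rw [setLIntegral_congr hHB', setLIntegral_congr hHB', S.augment_semigroup (hX s) hf,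
      S.augment_law μ hμ]
    have hB' := S.filt.le t B hB
    refine (setLIntegral_extendMeasure S.le_augSigma (hf.comp (hX (t + s))) hB').trans ?_
    refine (markov μ hμ s t f hf B hB).trans ?_
    exact (setLIntegral_extendMeasure S.le_augSigma
      ((S.measurable_semigroup (hX s) hf).comp (hX t)) hB').symm
  · have hsg : ∀ t, S.augment.semigroup t f = S.semigroup t f := fun t =>
      S.augment_semigroup (hX t) hf.measurable
    refine (S.ae_augment_law hμ).2 (excessive_rightContinuous α hα f
      ⟨hf.measurable, fun t x => ?_, fun x => ?_⟩ μ hμ)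
    · rw [← hsg]
      exact hf.le t x
    · simp only [← hsg]
      exact hf.tendsto x
  · have := hA μ hμ
    rw [S.augment_law μ hμ] at this
    exact nullMeasurableSet_of_extendMeasure S.le_augSigma this
  · obtain ⟨B, hB, hAB⟩ := hA μ hμ
    obtain ⟨B', hB', hBB'⟩ := hB μ hμ
    exact ⟨B', hB', EventuallyEq.trans ((S.ae_augment_law hμ).1 hAB) hBB'⟩

end augment

/-! ### The process `ψ(X)` -/

section kill

theorem inl_killMap_cases {EΔ : Type u} {F : Type w} {Δ : EΔ} (x : EΔ ⊕ F) :
    Sum.inl (killMap F Δ x) = x ∨ killMap F Δ x = Δ := by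
  rcases x with x | y
  · exact Or.inl rfl
  · exact Or.inr rfl

variable {EΔ : Type u} {F : Type w} [TopologicalSpace EΔ] [TopologicalSpace F]

theorem continuous_killMap (Δ : EΔ) : Continuous (killMap F Δ) :=
  continuous_id.sumElim continuous_const

variable (S : MarkovSystem.{max u w, v} (EΔ ⊕ F)) (Δ : EΔ)

/-- The process `ψ(X)` on `EΔ` over the filtered space of `X`, before augmentation. -/
noncomputable def killRaw : MarkovSystem.{u, v} EΔ where
  Ω := S.Ω
  𝓖 := S.𝓖
  filt := S.filt
  X := fun t ω => killMap F Δ (S.X t ω)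
  θ := S.θ
  P := Kernel.comap S.P Sum.inl (measurable_univMeas_of_continuous continuous_inl)

/-- This turns almost sure and integral statements about `ψ(X)` under an initial law into statements
about `X`. -/
theorem killRaw_law (μ : Measure EΔ) :
    (S.killRaw Δ).law μ = S.law (μ.map Sum.inl) := by
  have hinl : Measurable (Sum.inl : EΔ → EΔ ⊕ F) :=
    measurable_univMeas_of_continuous continuous_inl
  refine Measure.ext fun A hA => ((S.killRaw Δ).law_apply μ hA).trans ?_
  refine Eq.trans ?_ (S.law_apply _ hA).symm
  exact (lintegral_map (S.P.measurable_coe hA) hinl).symm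

variable {S Δ}

/-- Started in `F` or in `Δ`, the process `ψ(X)` almost surely rests in `Δ`. -/
theorem ae_killMap_eq (hΔ : S.IsAbsorbing {Sum.inl Δ}) (hF : S.IsAbsorbing (range Sum.inr))
    {x : EΔ ⊕ F} (hx : killMap F Δ x = Δ) : ∀ᵐ ω ∂(S.P x), ∀ t, killMap F Δ (S.X t ω) = Δ := by
  rcases x with x | y
  · obtain rfl : x = Δ := hx
    filter_upwards [hΔ.2 _ rfl] with ω hω t
    rw [hω t]
    rfl
  · filter_upwards [hF.2 _ ⟨y, rfl⟩] with ω hω t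
    obtain ⟨z, hz⟩ := hω t
    rw [← hz]
    rfl

theorem killRaw_semigroup (hS : ∀ x, IsProbabilityMeasure (S.P x))
    (hΔ : S.IsAbsorbing {Sum.inl Δ}) (hF : S.IsAbsorbing (range Sum.inr)) (t : ℝ≥0)
    (f : EΔ → ℝ≥0∞) (x : EΔ ⊕ F) :
    (S.killRaw Δ).semigroup t f (killMap F Δ x) = S.semigroup t (f ∘ killMap F Δ) x := by
  have hconst : ∀ y : EΔ ⊕ F, killMap F Δ y = Δ → S.semigroup t (f ∘ killMap F Δ) y = f Δ := by
    intro y hy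
    have : S.semigroup t (f ∘ killMap F Δ) y = ∫⁻ _, f Δ ∂(S.P y) := by
      refine lintegral_congr_ae ?_
      filter_upwards [ae_killMap_eq hΔ hF hy] with ω hω
      exact congrArg f (hω t)
    rw [this, lintegral_const, measure_univ, mul_one]
  -- By definition, `ψ(X)` started in `ψ(x)` uses the measure of `X` started in `Sum.inl (ψ x)`.
  change S.semigroup t (f ∘ killMap F Δ) (Sum.inl (killMap F Δ x)) = _
  rcases inl_killMap_cases (Δ := Δ) x with h | h
  · rw [h]
  · rw [hconst x h, h]
    exact hconst _ rfl

theorem isExcessive_comp_killMap (hS : ∀ x, IsProbabilityMeasure (S.P x))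
    (hΔ : S.IsAbsorbing {Sum.inl Δ}) (hF : S.IsAbsorbing (range Sum.inr)) {α : ℝ≥0}
    {f : EΔ → ℝ≥0∞} (hf : (S.killRaw Δ).IsExcessive α f) :
    S.IsExcessive α (f ∘ killMap F Δ) where
  measurable := hf.measurable.comp (measurable_univMeas_of_continuous (continuous_killMap Δ))
  le t x := by
    rw [← killRaw_semigroup hS hΔ hF]
    exact hf.le t _
  tendsto x := by
    simp only [← killRaw_semigroup hS hΔ hF]
    exact hf.tendsto _

theorem isRightProc_kill (hE : IsRadonSpace EΔ) (hS : S.IsRightProc)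
    (hΔ : S.IsAbsorbing {Sum.inl Δ}) (hF : S.IsAbsorbing (range Sum.inr)) :
    (S.kill Δ).IsRightProc := by
  have hψ : Measurable (killMap F Δ) := measurable_univMeas_of_continuous (continuous_killMap Δ)
  have hinl : Measurable (Sum.inl : EΔ → EΔ ⊕ F) :=
    measurable_univMeas_of_continuous continuous_inl
  have hP := hS.isProbabilityMeasure
  have hmap : ∀ μ : Measure EΔ, IsProbabilityMeasure μ →
      IsProbabilityMeasure (μ.map (Sum.inl : EΔ → EΔ ⊕ F)) := fun μ _ =>
    Measure.isProbabilityMeasure_map hinl.aemeasurable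
  -- `S.kill Δ` is by definition the augmentation of `S.killRaw Δ`.
  refine isRightProc_augment (S.killRaw Δ) hE (fun x => hP (Sum.inl x))
    (fun t => hψ.comp (hS.adapted t)) (fun x => ?_)
    (fun ω t => (continuous_killMap Δ).continuousAt.comp_continuousWithinAt
      (hS.rightContinuous ω t))
    (fun s t ω => congrArg (killMap F Δ) (hS.shift s t ω)) (fun μ hμ s t f hf H hH => ?_)
    (fun α hα f hf μ hμ => ?_) hS.filt_rightContinuous
  · have h : ∀ᵐ ω ∂(S.P (Sum.inl x)), killMap F Δ (S.X 0 ω) = x := by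
      filter_upwards [hS.normal (Sum.inl x)] with ω hω
      rw [hω]
      rfl
    exact h
  · rw [killRaw_law]
    refine (hS.markov _ (hmap μ hμ) s t (f ∘ killMap F Δ) (hf.comp hψ) H hH).trans ?_
    exact lintegral_congr fun ω => (killRaw_semigroup hP hΔ hF s f (S.X t ω)).symm
  · rw [killRaw_law]
    exact hS.excessive_rightContinuous α hα _ (isExcessive_comp_killMap hP hΔ hF hf) _ (hmap μ hμ)

theorem isAbsorbing_kill (hΔ : S.IsAbsorbing {Sum.inl Δ}) (hF : S.IsAbsorbing (range Sum.inr)) :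
    (S.kill Δ).IsAbsorbing {Δ} := by
  constructor
  · have h := measurable_univMeas_of_continuous (continuous_inl : Continuous
      (Sum.inl : EΔ → EΔ ⊕ F)) hΔ.1
    convert h using 1
    ext x
    simp
  · intro x hx
    exact (S.killRaw Δ).ae_augment_P.2 (ae_killMap_eq hΔ hF hx)

/-- Two starting points with the same image under `ψ` give the same law to `ψ(X)`. -/
theorem kill_P_apply (hS : ∀ x, IsProbabilityMeasure (S.P x)) (hX : ∀ t, Measurable (S.X t))
    (hΔ : S.IsAbsorbing {Sum.inl Δ}) (hF : S.IsAbsorbing (range Sum.inr)) (x : EΔ ⊕ F)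
    {H : Set S.Ω}
    (hH : MeasurableSet[⨆ t, (univMeas EΔ).comap fun ω => killMap F Δ (S.X t ω)] H) :
    (S.kill Δ).P (killMap F Δ x) H = S.P x H := by
  have hψ : Measurable (killMap F Δ) := measurable_univMeas_of_continuous (continuous_killMap Δ)
  have hHS : MeasurableSet[S.𝓖] H :=
    (iSup_le fun t => (hψ.comp (hX t)).comap_le :
      (⨆ t, (univMeas EΔ).comap fun ω => killMap F Δ (S.X t ω)) ≤ S.𝓖) H hH
  have hP : (S.kill Δ).P (killMap F Δ x) H = S.P (Sum.inl (killMap F Δ x)) H :=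
    (S.killRaw Δ).augment_P_apply _ ((S.killRaw Δ).le_augSigma H hHS)
  rw [hP]
  rcases inl_killMap_cases (Δ := Δ) x with h | h
  · rw [h]
  -- Now `ψ(x) = Δ`. The event `H` is the preimage of a set `C` of paths; as the path is almost
  -- surely constant `Δ`, both probabilities are 1 or 0 according to whether `C` contains that path.
  have hle : (⨆ t, (univMeas EΔ).comap fun ω => killMap F Δ (S.X t ω)) ≤
      MeasurableSpace.pi.comap fun ω (t : ℝ≥0) => killMap F Δ (S.X t ω) :=
    iSup_le fun t => Measurable.comap_le
      ((measurable_pi_apply t).comp (comap_measurable fun ω (t : ℝ≥0) => killMap F Δ (S.X t ω)))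
  obtain ⟨C, -, rfl⟩ := hle H hH
  have hC : ∀ y : EΔ ⊕ F, killMap F Δ y = Δ →
      S.P y ((fun ω (t : ℝ≥0) => killMap F Δ (S.X t ω)) ⁻¹' C) =
        S.P y {_ω | (fun _ : ℝ≥0 => Δ) ∈ C} := by
    intro y hy
    refine measure_congr ?_
    filter_upwards [ae_killMap_eq hΔ hF hy] with ω hω
    exact congrArg C (funext hω)
  rw [hC x h, h, hC _ rfl]
  by_cases hc : (fun _ : ℝ≥0 => Δ) ∈ C <;> simp [hc]

end kill

end MarkovSystem

end RightProc

theorem mainTheorem8 {EΔ : Type u} {F : Type w} [TopologicalSpace EΔ] [TopologicalSpace F]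
    (hEΔ : RightProc.IsRadonSpace EΔ) (hF : RightProc.IsRadonSpace F) (Δ : EΔ)
    (X : RightProc.MarkovSystem.{max u w, v} (EΔ ⊕ F)) (hX : X.IsRightProc)
    (hΔ : X.IsAbsorbing {Sum.inl Δ}) (hXF : X.IsAbsorbing (Set.range Sum.inr)) :
    (X.kill Δ).IsRightProc ∧ (X.kill Δ).IsAbsorbing {Δ} ∧
      ∀ (x : EΔ ⊕ F) (H : Set X.Ω),
        MeasurableSet[⨆ t, (RightProc.univMeas EΔ).comap
          fun ω => RightProc.MarkovSystem.killMap F Δ (X.X t ω)] H →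
        (X.kill Δ).P (RightProc.MarkovSystem.killMap F Δ x) H = X.P x H := by
  have hm : ∀ t, @Measurable X.Ω (EΔ ⊕ F) X.𝓖 (RightProc.univMeas _) (X.X t) := fun t =>
    (hX.adapted t).mono (X.filt.le t) le_rfl
  exact ⟨RightProc.MarkovSystem.isRightProc_kill hEΔ hX hΔ hXF,
    RightProc.MarkovSystem.isAbsorbing_kill hΔ hXF, fun x _ hH =>
      RightProc.MarkovSystem.kill_P_apply hX.isProbabilityMeasure hm hΔ hXF x hH⟩
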